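/- Let $m\ge 0$ and let $\mathbf r=(r_0,r_1,\ldots,r_m)$ be nonnegative integers with $r_0>0$ and $r_0+r_1+\cdots+r_m>1$. For $n\ge 0$ put $$S^{(\mathbf r)}_n=\sum_{k=0}^n \binom{n}{k}^{r_0}\binom{n+k}{k}^{r_1}\cdots\binom{n+km}{k}^{r_m}.$$ Then there is a positive integer $n_{\mathbf r}$ such that the sequence $$\frac{\bigl(S^{(\mathbf r)}_{n+1}\bigr)^{1/(n+1)}}{\bigl(S^{(\mathbf r)}_n\bigr)^{1/n}},\qquad n\ge n_{\mathbf r},$$ is strictly decreasing. In particular, for each of the sequences of Apéry numbers $A_n=\sum_{k=0}^n\binom nk^2\binom{n+k}k^2$ (the case $\mathbf r=(2,2)$), central Delannoy numbers $d_n=\sum_{k=0}^n\binom nk\binom{n+k}k$ (the case $\mathbf r=(1,1)$) and Franel numbers $b_n=\sum_{k=0}^n\binom nk^3$ (the case $\mathbf r=(3)$), the sequence $u_{n+1}^{1/(n+1)}/u_n^{1/n}$, where $u_n$ is $A_n$, $d_n$ or $b_n$ respectively, is strictly decreasing from some index on. -/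

import Mathlib

open Finset

/-- The sum `S^{(r)}(n) = ∑_{k=0}^n C(n,k)^{r_0} C(n+k,k)^{r_1} ⋯ C(n+km,k)^{r_m}` attached to a
tuple `r = (r_0, …, r_m)` of nonnegative integers. -/
def binomSum {m : ℕ} (r : Fin (m + 1) → ℕ) (n : ℕ) : ℕ :=
  ∑ k ∈ range (n + 1), ∏ j : Fin (m + 1), (n + k * (j : ℕ)).choose k ^ r j

/-- The Apéry numbers. -/
def aperyNumber (n : ℕ) : ℕ :=
  ∑ k ∈ range (n + 1), n.choose k ^ 2 * (n + k).choose k ^ 2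

/-- The central Delannoy numbers. -/
def centralDelannoyNumber (n : ℕ) : ℕ :=
  ∑ k ∈ range (n + 1), n.choose k * (n + k).choose k

/-- The Franel numbers. -/
def franelNumber (n : ℕ) : ℕ :=
  ∑ k ∈ range (n + 1), n.choose k ^ 3

/-- The general term `u_{n+1}^{1/(n+1)} / u_n^{1/n}`, meaningful for `n ≥ 1`. -/
noncomputable def rootRatio (u : ℕ → ℕ) (n : ℕ) : ℝ :=
  (u (n + 1) : ℝ) ^ (1 / ((n : ℝ) + 1)) / (u n : ℝ) ^ (1 / (n : ℝ))

/-!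
Write `T(n, k)` for the summand of `S_n = binomSum r n` and `E_n F` for the mean of `F (k / n)` with
respect to the weights `T(n, k)`, `0 ≤ k ≤ n`.

**Expansion of the ratios.** The quotient `T(n, k + 1) / T(n, k)` is rational in `n` and `k`, so
summation by parts gives `E_n [H(x) a_n(x) - H(x - 1/n) b_n(x)] = 0` for *every* function `H`, where
`a_n = a₀ + a₁ / n + ⋯` and `b_n = b₀ + b₁ / n + ⋯` are products of linear forms
(`sum_binomTerm_stein`). On `[0, 1]` the difference `a₀ - b₀` has exactly one zero `x₀`, and it is
simple (`exists_concentration_point`). Hence every function analytic near `[0, 1]` and vanishing at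
`x₀` has the form `H (a₀ - b₀)` with `H` analytic, and the identity turns its mean into
`E_n G / n + O(1 / n²)` with `G` analytic. Applying this twice yields
`E_n F = F(x₀) + c / n + O(1 / n²)` (`SteinWeights.exists_mean_expansion`) without Stirling's
formula or Laplace's method. As `T(n, k) / T(n + 1, k)` is a function `F` of `k / (n + 1)` alone,
`S_n / S_{n+1} = E_{n+1} F = λ + c / (n + 1) + O(1 / n²)`.

**Growth.** For `k / n` near `x₀` and `r_0 + ⋯ + r_m ≥ 2`, `T(2n, 2k)` exceeds `T(n, k)²` by a factor
of order `n` (`mul_binomTerm_sq_le`). The weights concentrate in a window of `ε n` indices for every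
`ε > 0`, so Cauchy-Schwarz shows that `S_{2n} / S_n²` tends to infinity
(`eventually_mul_binomSum_sq_le`). It follows that `S_n λ^n` tends to `0`. This determines the sign
of the polynomial correction to `λ^{-n}` with no computation of `c`.

**Conclusion.** Put `l_n = log (S_n λ^n)`. The theorem says that the second difference of `l_n / n`
is eventually negative, that is, `n (n + 1) Δ²l_n < 2 (n Δl_n - l_n)`. The expansion bounds the left
side above and `n Δl_n` below, while `l_n` tends to `-∞` (`exists_strictAntiOn_rootRatio`).
-/

/-! ### Analytic functions on the unit interval -/

theorem AnalyticOnNhd.exists_abs_le {f : ℝ → ℝ} (hf : AnalyticOnNhd ℝ f (Set.Icc 0 1)) :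
    ∃ C, 0 ≤ C ∧ ∀ x ∈ Set.Icc (0 : ℝ) 1, |f x| ≤ C := by
  obtain ⟨C, hC⟩ := isCompact_Icc.exists_bound_of_continuousOn hf.continuousOn
  exact ⟨C, (abs_nonneg _).trans (hC 0 (by simp)), hC⟩

/-- The quotient `(f x - f c) / (x - c)`, extended by `f' c` at `c`, is analytic wherever `f` is. -/
theorem AnalyticOnNhd.dslope {f : ℝ → ℝ} {s : Set ℝ} {c : ℝ} (hf : AnalyticOnNhd ℝ f s)
    (hc : c ∈ s) : AnalyticOnNhd ℝ (dslope f c) s := by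
  intro x hx
  rcases eq_or_ne x c with rfl | hne
  · obtain ⟨p, hp⟩ := hf x hx
    exact ⟨_, hp.has_fpower_series_dslope_fslope⟩
  · have h1 : AnalyticAt ℝ (fun y => (f y - f c) / (y - c)) x :=
      ((hf x hx).sub analyticAt_const).div (analyticAt_id.sub analyticAt_const)
        (sub_ne_zero.2 hne)
    refine h1.congr ?_
    filter_upwards [isOpen_ne.mem_nhds hne] with y hy
    rw [dslope_of_ne _ hy, slope_def_field]

theorem AnalyticOnNhd.exists_abs_sub_le {f : ℝ → ℝ} (hf : AnalyticOnNhd ℝ f (Set.Icc 0 1)) :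
    ∃ C, 0 ≤ C ∧ ∀ x ∈ Set.Icc (0 : ℝ) 1, ∀ y ∈ Set.Icc (0 : ℝ) 1, |f y - f x| ≤ C * |y - x| := by
  obtain ⟨C, hC0, hC⟩ := hf.deriv.exists_abs_le
  refine ⟨C, hC0, fun x hx y hy => ?_⟩
  exact (convex_Icc (0 : ℝ) 1).norm_image_sub_le_of_norm_deriv_le
    (fun z hz => (hf z hz).differentiableAt) hC hx hy

theorem AnalyticOnNhd.exists_abs_taylor_le {f : ℝ → ℝ} (hf : AnalyticOnNhd ℝ f (Set.Icc 0 1)) :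
    ∃ C, 0 ≤ C ∧ ∀ x ∈ Set.Icc (0 : ℝ) 1, ∀ y ∈ Set.Icc (0 : ℝ) 1,
      |f y - f x - deriv f x * (y - x)| ≤ C * (y - x) ^ 2 := by
  obtain ⟨C, hC0, hC⟩ := hf.deriv.exists_abs_sub_le
  refine ⟨C, hC0, fun x hx y hy => ?_⟩
  have hsub : Set.uIcc x y ⊆ Set.Icc 0 1 := by
    rw [← segment_eq_uIcc]
    exact (convex_Icc (0 : ℝ) 1).segment_subset hx hy
  have hder : ∀ z ∈ Set.uIcc x y,
      HasDerivWithinAt (fun t => f t - deriv f x * t) (deriv f z - deriv f x) (Set.uIcc x y) z := by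
    intro z hz
    have h1 := (hf z (hsub hz)).differentiableAt.hasDerivAt
    have h2 : HasDerivAt (fun t => f t - deriv f x * t) (deriv f z - deriv f x * 1) z :=
      h1.sub ((hasDerivAt_id z).const_mul (deriv f x))
    rw [mul_one] at h2
    exact h2.hasDerivWithinAt
  have hbd : ∀ z ∈ Set.uIcc x y, ‖deriv f z - deriv f x‖ ≤ C * |y - x| := by
    intro z hz
    refine (hC x hx z (hsub hz)).trans ?_
    exact mul_le_mul_of_nonneg_left (Set.abs_sub_left_of_mem_uIcc hz) hC0
  have := (convex_uIcc x y).norm_image_sub_le_of_norm_hasDerivWithin_le hder hbd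
    Set.left_mem_uIcc Set.right_mem_uIcc
  rw [Real.norm_eq_abs, Real.norm_eq_abs, mul_assoc, abs_mul_abs_self] at this
  calc _ = |f y - deriv f x * y - (f x - deriv f x * x)| := by congr 1; ring
    _ ≤ _ := by rw [sq]; exact this

/-! ### First order expansions in `1 / n` -/

/-- `a n x = a₀ x + a₁ x / n + O(1 / n ^ 2)` uniformly for `x ∈ [0, 1]`, with `a₀` and `a₁` analytic
on a neighbourhood of `[0, 1]`. -/
def HasExpansion (a : ℕ → ℝ → ℝ) (a₀ : ℝ → ℝ) : Prop :=
  AnalyticOnNhd ℝ a₀ (Set.Icc 0 1) ∧ ∃ a₁, AnalyticOnNhd ℝ a₁ (Set.Icc 0 1) ∧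
    ∃ C, 0 ≤ C ∧ ∀ n : ℕ, 1 ≤ n → ∀ x ∈ Set.Icc (0 : ℝ) 1,
      |a n x - (a₀ x + a₁ x / n)| ≤ C / n ^ 2

namespace HasExpansion

theorem linear (α β γ : ℝ) :
    HasExpansion (fun n x => α + β * x + γ / n) (fun x => α + β * x) := by
  refine ⟨?_, fun _ => γ, analyticOnNhd_const, 0, le_rfl, fun n _ x _ => by simp⟩
  exact analyticOnNhd_const.add (analyticOnNhd_const.mul analyticOnNhd_id)

theorem mul {a b : ℕ → ℝ → ℝ} {a₀ b₀ : ℝ → ℝ} (ha : HasExpansion a a₀) (hb : HasExpansion b b₀) :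
    HasExpansion (fun n x => a n x * b n x) (fun x => a₀ x * b₀ x) := by
  obtain ⟨ha₀, a₁, ha₁, C, hC, hCa⟩ := ha
  obtain ⟨hb₀, b₁, hb₁, D, hD, hDb⟩ := hb
  obtain ⟨A₀, hA₀, hA₀'⟩ := ha₀.exists_abs_le
  obtain ⟨A₁, hA₁, hA₁'⟩ := ha₁.exists_abs_le
  obtain ⟨B₀, hB₀, hB₀'⟩ := hb₀.exists_abs_le
  obtain ⟨B₁, hB₁, hB₁'⟩ := hb₁.exists_abs_le
  refine ⟨ha₀.mul hb₀, fun x => a₀ x * b₁ x + a₁ x * b₀ x, (ha₀.mul hb₁).add (ha₁.mul hb₀),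
    C * (B₀ + B₁ + D) + (A₀ + A₁) * D + A₁ * B₁, by positivity, fun n hn x hx => ?_⟩
  have hn1 : (1 : ℝ) ≤ n := by exact_mod_cast hn
  have hn0 : (0 : ℝ) < n := by linarith
  set u := a₀ x + a₁ x / n
  set v := b₀ x + b₁ x / n
  have hdiv : ∀ {t T : ℝ}, |t| ≤ T → |t / n| ≤ T := fun {t T} h => by
    rw [abs_div, abs_of_pos hn0]
    exact (div_le_self (abs_nonneg _) hn1).trans h
  have hu : |u| ≤ A₀ + A₁ := (abs_add_le _ _).trans (add_le_add (hA₀' x hx) (hdiv (hA₁' x hx)))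
  have hv : |v| ≤ B₀ + B₁ := (abs_add_le _ _).trans (add_le_add (hB₀' x hx) (hdiv (hB₁' x hx)))
  have h1 := hCa n hn x hx
  have h2 := hDb n hn x hx
  have h2' : |b n x - v| ≤ D := h2.trans (div_le_self hD (one_le_pow₀ hn1))
  have hbn : |b n x| ≤ B₀ + B₁ + D := by
    calc |b n x| = |v + (b n x - v)| := by congr 1; ring
      _ ≤ |v| + |b n x - v| := abs_add_le _ _
      _ ≤ _ := add_le_add hv h2'
  have key : a n x * b n x - (a₀ x * b₀ x + (a₀ x * b₁ x + a₁ x * b₀ x) / n)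
      = (a n x - u) * b n x + u * (b n x - v) + a₁ x * b₁ x / n ^ 2 := by
    simp only [u, v]; field_simp; ring
  rw [key]
  calc _ ≤ |a n x - u| * |b n x| + |u| * |b n x - v| + |a₁ x| * |b₁ x| / n ^ 2 := by
        refine (abs_add_three _ _ _).trans (le_of_eq ?_)
        rw [abs_mul, abs_mul, abs_div, abs_mul, abs_of_pos (pow_pos hn0 2)]
    _ ≤ C / n ^ 2 * (B₀ + B₁ + D) + (A₀ + A₁) * (D / n ^ 2) + A₁ * B₁ / n ^ 2 := by
        gcongr
        · exact hA₁' x hx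
        · exact hB₁' x hx
    _ = _ := by ring

theorem pow {a : ℕ → ℝ → ℝ} {a₀ : ℝ → ℝ} (ha : HasExpansion a a₀) (e : ℕ) :
    HasExpansion (fun n x => a n x ^ e) (fun x => a₀ x ^ e) := by
  induction e with
  | zero => simpa using linear 1 0 0
  | succ e ih => simpa only [pow_succ] using ih.mul ha

theorem prod {ι : Type*} {a : ι → ℕ → ℝ → ℝ} {a₀ : ι → ℝ → ℝ} (s : Finset ι)
    (ha : ∀ i ∈ s, HasExpansion (a i) (a₀ i)) :
    HasExpansion (fun n x => ∏ i ∈ s, a i n x) (fun x => ∏ i ∈ s, a₀ i x) := by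
  classical
  induction s using Finset.induction_on with
  | empty => simpa using linear 1 0 0
  | insert i s hi ih =>
    simp only [Finset.prod_insert hi]
    exact (ha i (by simp)).mul (ih fun j hj => ha j (by simp [hj]))

end HasExpansion

/-! ### Expansion of weighted means -/

/-- The mean of `F (k / n)` over `0 ≤ k ≤ n` with respect to the weights `w n k`. -/
noncomputable def weightedMean (w : ℕ → ℕ → ℝ) (n : ℕ) (F : ℝ → ℝ) : ℝ :=
  (∑ k ∈ range (n + 1), w n k * F (k / n)) / ∑ k ∈ range (n + 1), w n k

theorem div_mem_Icc_of_mem_range {n k : ℕ} (hk : k ∈ range (n + 1)) :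
    (k : ℝ) / n ∈ Set.Icc (0 : ℝ) 1 := by
  have : k ≤ n := Nat.lt_succ_iff.1 (mem_range.1 hk)
  exact ⟨by positivity, div_le_one_of_le₀ (by exact_mod_cast this) (by positivity)⟩

theorem abs_weightedMean_le {w : ℕ → ℕ → ℝ} {n : ℕ} (hw : ∀ k, 0 ≤ w n k)
    {F : ℝ → ℝ} {C : ℝ} (hC : 0 ≤ C) (hF : ∀ x ∈ Set.Icc (0 : ℝ) 1, |F x| ≤ C) :
    |weightedMean w n F| ≤ C := by
  have hS : 0 ≤ ∑ k ∈ range (n + 1), w n k := sum_nonneg fun k _ => hw k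
  rw [weightedMean, abs_div, abs_of_nonneg hS]
  refine div_le_of_le_mul₀ hS hC ?_
  rw [mul_sum]
  refine (abs_sum_le_sum_abs _ _).trans (sum_le_sum fun k hk => ?_)
  rw [abs_mul, abs_of_nonneg (hw k), mul_comm]
  exact mul_le_mul_of_nonneg_right (hF _ (div_mem_Icc_of_mem_range hk)) (hw k)

/-- Weights satisfying a summation-by-parts identity: `a n` and `b n` are the two sides of the
recurrence in `k` of the weights `w n k`, in the rescaled variable `x = k / n`, both have an
expansion in `1 / n`, and the difference of the leading coefficients has a single simple zero
`x₀` in `[0, 1]`, the point at which the weights concentrate. -/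
structure SteinWeights (w : ℕ → ℕ → ℝ) (x₀ : ℝ) where
  a : ℕ → ℝ → ℝ
  b : ℕ → ℝ → ℝ
  a₀ : ℝ → ℝ
  b₀ : ℝ → ℝ
  nonneg : ∀ n k, 0 ≤ w n k
  sum_pos : ∀ n, 0 < ∑ k ∈ range (n + 1), w n k
  expansion_a : HasExpansion a a₀
  expansion_b : HasExpansion b b₀
  b_zero : ∀ n, b n 0 = 0
  b₀_zero : b₀ 0 = 0
  stein : ∀ n : ℕ, 1 ≤ n → ∀ H : ℝ → ℝ, ∑ k ∈ range (n + 1),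
    w n k * (H (k / n) * a n (k / n) - H (k / n - 1 / n) * b n (k / n)) = 0
  mem : x₀ ∈ Set.Icc (0 : ℝ) 1
  eq_at : a₀ x₀ = b₀ x₀
  ne_of_ne : ∀ x ∈ Set.Icc (0 : ℝ) 1, x ≠ x₀ → a₀ x ≠ b₀ x
  deriv_ne : deriv (fun x => a₀ x - b₀ x) x₀ ≠ 0

namespace SteinWeights

variable {w : ℕ → ℕ → ℝ} {x₀ : ℝ}

/-- The Stein identity with `H (x - 1 / n)` replaced by its Taylor polynomial of degree one. -/
theorem exists_mean_mul_sub (h : SteinWeights w x₀) {H : ℝ → ℝ}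
    (hH : AnalyticOnNhd ℝ H (Set.Icc 0 1)) :
    ∃ K : ℝ → ℝ, AnalyticOnNhd ℝ K (Set.Icc 0 1) ∧ ∃ C, 0 ≤ C ∧ ∀ n : ℕ, 1 ≤ n →
      |weightedMean w n (fun x => H x * (h.a₀ x - h.b₀ x)) - weightedMean w n K / n|
        ≤ C / n ^ 2 := by
  obtain ⟨ha₀, a₁, ha₁, Ca, hCa, hCa'⟩ := h.expansion_a
  obtain ⟨hb₀, b₁, hb₁, Cb, hCb, hCb'⟩ := h.expansion_b
  obtain ⟨CH, hCH, hCH'⟩ := hH.exists_abs_le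
  obtain ⟨CL, hCL, hCL'⟩ := hH.exists_abs_sub_le
  obtain ⟨CT, hCT, hCT'⟩ := hH.exists_abs_taylor_le
  obtain ⟨B₀, hB₀, hB₀'⟩ := hb₀.exists_abs_le
  obtain ⟨B₁, hB₁, hB₁'⟩ := hb₁.exists_abs_le
  set K : ℝ → ℝ := fun x => H x * (b₁ x - a₁ x) - deriv H x * h.b₀ x with hK
  set C := CH * Ca + CH * Cb + CL * Cb + CT * B₀ + CL * B₁ with hCdef
  have hC : 0 ≤ C := by positivity
  refine ⟨K, (hH.mul (hb₁.sub ha₁)).sub (hH.deriv.mul hb₀), C, hC, fun n hn => ?_⟩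
  have hn1 : (1 : ℝ) ≤ n := by exact_mod_cast hn
  have hn0 : (0 : ℝ) < n := by linarith
  -- At `x = 0` the point `x - 1 / n` leaves the unit interval, but there `b n` vanishes.
  have pointwise : ∀ k ∈ range (n + 1),
      |H (k / n) * (h.a₀ (k / n) - h.b₀ (k / n)) - K (k / n) / n
        - (H (k / n) * h.a n (k / n) - H (k / n - 1 / n) * h.b n (k / n))| ≤ C / n ^ 2 := by
    intro k hk
    have hx := div_mem_Icc_of_mem_range hk
    set x : ℝ := k / n with hxdef
    have e1 := hCa' n hn x hx
    have e2 := hCb' n hn x hx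
    have e3 := hCH' x hx
    rcases Nat.eq_zero_or_pos k with rfl | hkpos
    · have hx0 : x = 0 := by simp [hxdef]
      rw [hx0] at e1 e2 e3 ⊢
      rw [h.b_zero, h.b₀_zero] at *
      simp only [hK, h.b₀_zero]
      have : H 0 * (h.a₀ 0 - 0) - (H 0 * (b₁ 0 - a₁ 0) - deriv H 0 * 0) / n
          - (H 0 * h.a n 0 - H (0 - 1 / n) * 0)
          = -(H 0 * (h.a n 0 - (h.a₀ 0 + a₁ 0 / n))) + H 0 * (0 - (0 + b₁ 0 / n)) := by ring
      rw [this]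
      calc _ ≤ |H 0| * |h.a n 0 - (h.a₀ 0 + a₁ 0 / n)| + |H 0| * |0 - (0 + b₁ 0 / n)| := by
            refine (abs_add_le _ _).trans (le_of_eq ?_)
            rw [abs_neg, abs_mul, abs_mul]
        _ ≤ CH * (Ca / n ^ 2) + CH * (Cb / n ^ 2) := by gcongr
        _ = (CH * Ca + CH * Cb) / n ^ 2 := by ring
        _ ≤ C / n ^ 2 := by
            gcongr
            have : 0 ≤ CL * Cb + CT * B₀ + CL * B₁ := by positivity
            linarith
    · have hxge : 1 / (n : ℝ) ≤ x := by
        rw [hxdef]; gcongr; exact_mod_cast hkpos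
      have hy : x - 1 / n ∈ Set.Icc (0 : ℝ) 1 :=
        ⟨by linarith, by have := hx.2; have : 0 < 1 / (n : ℝ) := by positivity
                         linarith⟩
      have e4 := hCL' x hx _ hy
      have e5 := hCT' x hx _ hy
      have e6 : |x - 1 / n - x| = 1 / (n : ℝ) := by
        rw [show x - 1 / n - x = -(1 / (n : ℝ)) by ring, abs_neg, abs_of_pos (by positivity)]
      rw [e6] at e4
      rw [show x - 1 / n - x = -(1 / (n : ℝ)) by ring] at e5
      have e4' : |H (x - 1 / n) - H x| ≤ CL :=
        e4.trans (mul_le_of_le_one_right hCL (by rw [div_le_one hn0]; exact hn1))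
      have key : H x * (h.a₀ x - h.b₀ x) - K x / n
          - (H x * h.a n x - H (x - 1 / n) * h.b n x)
          = -(H x * (h.a n x - (h.a₀ x + a₁ x / n)))
            + H x * (h.b n x - (h.b₀ x + b₁ x / n))
            + (H (x - 1 / n) - H x) * (h.b n x - (h.b₀ x + b₁ x / n))
            + (H (x - 1 / n) - H x - deriv H x * -(1 / n)) * h.b₀ x
            + (H (x - 1 / n) - H x) * b₁ x / n := by
        simp only [hK]; ring
      rw [key]
      calc _ ≤ |H x| * |h.a n x - (h.a₀ x + a₁ x / n)|
            + |H x| * |h.b n x - (h.b₀ x + b₁ x / n)|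
            + |H (x - 1 / n) - H x| * |h.b n x - (h.b₀ x + b₁ x / n)|
            + |H (x - 1 / n) - H x - deriv H x * -(1 / n)| * |h.b₀ x|
            + |H (x - 1 / n) - H x| * |b₁ x| / n := by
              refine (abs_add_le _ _).trans (add_le_add ((abs_add_le _ _).trans
                (add_le_add ((abs_add_le _ _).trans (add_le_add ((abs_add_le _ _).trans
                (add_le_add ?_ ?_)) ?_)) ?_)) ?_) <;>
              simp only [abs_neg, abs_mul, abs_div, Nat.abs_cast, le_refl]
        _ ≤ CH * (Ca / n ^ 2) + CH * (Cb / n ^ 2) + CL * (Cb / n ^ 2)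
            + (CT * (-(1 / n)) ^ 2) * B₀ + (CL * (1 / n)) * B₁ / n := by
              gcongr
              · exact hB₀' x hx
              · exact hB₁' x hx
        _ = C / n ^ 2 := by rw [hCdef]; field_simp
  have hS := h.sum_pos n
  have hsum : weightedMean w n (fun x => H x * (h.a₀ x - h.b₀ x)) - weightedMean w n K / n
      = (∑ k ∈ range (n + 1), w n k * (H (k / n) * (h.a₀ (k / n) - h.b₀ (k / n)) - K (k / n) / n
        - (H (k / n) * h.a n (k / n) - H (k / n - 1 / n) * h.b n (k / n))))
        / ∑ k ∈ range (n + 1), w n k := by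
    simp only [mul_sub (w n _), sum_sub_distrib]
    simp only [← sum_sub_distrib, ← mul_sub]
    have := h.stein n hn H
    simp only [mul_sub (w n _), sum_sub_distrib] at this ⊢
    rw [this, sub_zero, weightedMean, weightedMean, sub_div, div_div, mul_comm _ (n : ℝ),
      ← div_div, sum_div, sum_div]
    simp only [mul_div_assoc, mul_sub]
  rw [hsum, abs_div, abs_of_pos hS, div_le_iff₀ hS, mul_sum]
  refine (abs_sum_le_sum_abs _ _).trans (sum_le_sum fun k hk => ?_)
  rw [abs_mul, abs_of_nonneg (h.nonneg n k), mul_comm]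
  exact mul_le_mul_of_nonneg_right (pointwise k hk) (h.nonneg n k)

/-- Every `F - F x₀` is a multiple of `a₀ - b₀` by an analytic function, so the Stein identity
expresses its mean as `1 / n` times the mean of another analytic function. -/
theorem exists_mean_sub (h : SteinWeights w x₀) {F : ℝ → ℝ}
    (hF : AnalyticOnNhd ℝ F (Set.Icc 0 1)) :
    ∃ G : ℝ → ℝ, AnalyticOnNhd ℝ G (Set.Icc 0 1) ∧ ∃ C, 0 ≤ C ∧ ∀ n : ℕ, 1 ≤ n →
      |weightedMean w n F - F x₀ - weightedMean w n G / n| ≤ C / n ^ 2 := by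
  set d : ℝ → ℝ := fun x => h.a₀ x - h.b₀ x with hd
  have hda : AnalyticOnNhd ℝ d (Set.Icc 0 1) := h.expansion_a.1.sub h.expansion_b.1
  have hd0 : d x₀ = 0 := sub_eq_zero.2 h.eq_at
  have hQ : ∀ x ∈ Set.Icc (0 : ℝ) 1, dslope d x₀ x ≠ 0 := by
    intro x hx
    rcases eq_or_ne x x₀ with rfl | hne
    · rw [dslope_same]; exact h.deriv_ne
    · rw [dslope_of_ne _ hne, slope_def_field, hd0, sub_zero]
      exact div_ne_zero (sub_ne_zero.2 (h.ne_of_ne x hx hne)) (sub_ne_zero.2 hne)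
  obtain ⟨G, hG, C, hC, hGC⟩ := h.exists_mean_mul_sub ((hF.dslope h.mem).div (hda.dslope h.mem) hQ)
  refine ⟨G, hG, C, hC, fun n hn => ?_⟩
  have hS := h.sum_pos n
  have : weightedMean w n F - F x₀
      = weightedMean w n (fun x => (dslope F x₀ / dslope d x₀) x * (h.a₀ x - h.b₀ x)) := by
    have h1 : F x₀ = (∑ k ∈ range (n + 1), w n k * F x₀) / ∑ k ∈ range (n + 1), w n k := by
      rw [← sum_mul, mul_div_cancel_left₀ _ hS.ne']
    rw [h1, weightedMean, weightedMean, ← sub_div, ← sum_sub_distrib]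
    congr 1
    refine sum_congr rfl fun k hk => ?_
    rw [← mul_sub]
    congr 1
    have hx := div_mem_Icc_of_mem_range hk
    set x : ℝ := k / n
    have e1 : h.a₀ x - h.b₀ x = (x - x₀) * dslope d x₀ x := by
      have := sub_smul_dslope d x₀ x
      rw [smul_eq_mul, hd0, sub_zero] at this
      exact this.symm
    have e2 := sub_smul_dslope F x₀ x
    rw [smul_eq_mul] at e2
    rw [e1, Pi.div_apply, ← e2]
    field_simp [hQ x hx]
  rw [this]
  exact hGC n hn

/-- Means of analytic functions have an expansion in `1 / n` with error `O(1 / n ^ 2)`, obtained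
by using `exists_mean_sub` twice. -/
theorem exists_mean_expansion (h : SteinWeights w x₀) {F : ℝ → ℝ}
    (hF : AnalyticOnNhd ℝ F (Set.Icc 0 1)) :
    ∃ c C : ℝ, 0 ≤ C ∧ ∀ n : ℕ, 1 ≤ n →
      |weightedMean w n F - (F x₀ + c / n)| ≤ C / n ^ 2 := by
  obtain ⟨G, hG, C, hC, hGC⟩ := h.exists_mean_sub hF
  obtain ⟨G', hG', C', hC', hGC'⟩ := h.exists_mean_sub hG
  obtain ⟨B, hB, hB'⟩ := hG'.exists_abs_le
  refine ⟨G x₀, C + C' + B, by positivity, fun n hn => ?_⟩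
  have hn1 : (1 : ℝ) ≤ n := by exact_mod_cast hn
  have hn0 : (0 : ℝ) < n := by linarith
  have h1 := hGC n hn
  have h2 := hGC' n hn
  have h3 : |weightedMean w n G'| ≤ B := abs_weightedMean_le (h.nonneg n) hB hB'
  have key : weightedMean w n F - (F x₀ + G x₀ / n)
      = (weightedMean w n F - F x₀ - weightedMean w n G / n)
        + (weightedMean w n G - G x₀ - weightedMean w n G' / n) / n
        + weightedMean w n G' / n ^ 2 := by field_simp; ring
  rw [key]
  calc _ ≤ |weightedMean w n F - F x₀ - weightedMean w n G / n|
        + |weightedMean w n G - G x₀ - weightedMean w n G' / n| / n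
        + |weightedMean w n G'| / n ^ 2 := by
        refine (abs_add_three _ _ _).trans (le_of_eq ?_)
        rw [abs_div, abs_div, abs_of_pos hn0, abs_of_pos (pow_pos hn0 2)]
    _ ≤ C / n ^ 2 + (C' / n ^ 2) / 1 + B / n ^ 2 := by gcongr
    _ = _ := by ring

end SteinWeights

open Filter Topology

/-! ### From a second order expansion to monotonicity of root ratios -/

/-- If `l (2 * n) - 2 * l n` tends to infinity and the increments of `l` tend to zero, then `l` tends
to `-∞`. -/
theorem tendsto_atBot_of_doubling {l : ℕ → ℝ}
    (hslope : Tendsto (fun n => l (n + 1) - l n) atTop (𝓝 0))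
    (hdouble : ∀ M : ℝ, ∀ᶠ n in atTop, 2 * l n + M ≤ l (2 * n)) : Tendsto l atTop atBot := by
  have hmean : Tendsto (fun n : ℕ => l n / n) atTop (𝓝 0) := by
    have h1 := hslope.cesaro
    simp only [sum_range_sub] at h1
    have h2 : Tendsto (fun n : ℕ => l 0 / (n : ℝ)) atTop (𝓝 0) :=
      tendsto_const_nhds.div_atTop tendsto_natCast_atTop_atTop
    have h3 := h1.add h2
    rw [add_zero] at h3
    refine h3.congr fun n => ?_
    ring
  obtain ⟨N, hN⟩ := eventually_atTop.1 (hdouble 0)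
  have hnonpos : ∀ n, max N 1 ≤ n → l n ≤ 0 := by
    intro n hn
    have hnN : N ≤ n := (le_max_left _ _).trans hn
    have hn0 : 0 < n := (le_max_right N 1).trans hn
    have hpow : ∀ j : ℕ, l n ≤ n * (l (2 ^ j * n) / ((2 ^ j * n : ℕ) : ℝ)) := by
      intro j
      have h1 : 2 ^ j * l n ≤ l (2 ^ j * n) := by
        induction j with
        | zero => simp
        | succ j ih =>
          have h2 := hN (2 ^ j * n) (hnN.trans (Nat.le_mul_of_pos_left _ (by positivity)))
          rw [← mul_assoc, ← pow_succ'] at h2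
          rw [pow_succ']
          linarith
      have hn' : (0 : ℝ) < n := by exact_mod_cast hn0
      push_cast
      rw [← mul_div_assoc, mul_comm (2 ^ j : ℝ), mul_div_mul_left _ _ hn'.ne',
        le_div_iff₀ (by positivity)]
      linarith
    have hlim : Tendsto (fun j : ℕ => n * (l (2 ^ j * n) / ((2 ^ j * n : ℕ) : ℝ))) atTop (𝓝 0) := by
      have hsub : Tendsto (fun j : ℕ => 2 ^ j * n) atTop atTop :=
        (tendsto_pow_atTop_atTop_of_one_lt one_lt_two).atTop_mul_const' hn0
      simpa using (hmean.comp hsub).const_mul (n : ℝ)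
    -- The slope `l n / n` can only increase along `n, 2 n, 4 n, …`, and its limit is zero.
    exact ge_of_tendsto' hlim hpow
  refine tendsto_atBot.2 fun B => ?_
  filter_upwards [hdouble (-2 * B), eventually_ge_atTop (max N 1)] with n h1 h2
  have h3 := hnonpos (2 * n) (h2.trans (by omega))
  linarith

/-- The second difference of `l n / n` is negative as soon as `n * (n + 1)` times the second
difference of `l` is less than twice `n * (l (n + 1) - l n) - l n`. -/
theorem eventually_div_second_difference_neg {l : ℕ → ℝ} {D D' : ℝ} (hl : Tendsto l atTop atBot)
    (h1 : ∀ᶠ n : ℕ in atTop, -D ≤ n * (l (n + 1) - l n))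
    (h2 : ∀ᶠ n : ℕ in atTop, n * (n + 1) * (l (n + 2) - 2 * l (n + 1) + l n) ≤ D') :
    ∀ᶠ n : ℕ in atTop, l (n + 2) / ((n : ℝ) + 2) - l (n + 1) / ((n : ℝ) + 1)
      < l (n + 1) / ((n : ℝ) + 1) - l n / n := by
  filter_upwards [h1, h2, hl.eventually_lt_atBot (-D - D' / 2), eventually_ge_atTop 1]
    with n h1 h2 h3 hn
  have hn0 : (0 : ℝ) < n := by exact_mod_cast hn
  rw [← sub_neg]
  have key : l (n + 2) / ((n : ℝ) + 2) - l (n + 1) / ((n : ℝ) + 1)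
      - (l (n + 1) / ((n : ℝ) + 1) - l n / n)
      = (n * (n + 1) * (l (n + 2) - 2 * l (n + 1) + l n)
        - 2 * (n * (l (n + 1) - l n) - l n)) / (n * (n + 1) * (n + 2)) := by
    field_simp; ring
  rw [key]
  exact div_neg_of_neg_of_pos (by linarith) (by positivity)

theorem rootRatio_eq_exp {u : ℕ → ℕ} (hu : ∀ n, 0 < u n) (n : ℕ) :
    rootRatio u n
      = Real.exp (Real.log (u (n + 1)) / ((n : ℝ) + 1) - Real.log (u n) / n) := by
  have h : ∀ k, (0 : ℝ) < u k := fun k => by exact_mod_cast hu k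
  rw [rootRatio, Real.rpow_def_of_pos (h _), Real.rpow_def_of_pos (h _), ← Real.exp_sub]
  congr 1; ring

/-- If `u n / u (n + 1) = lam + c / (n + 1) + O(1 / n ^ 2)` and `u (2 * n) / u n ^ 2` tends to
infinity, the root ratios of `u` eventually decrease. The doubling hypothesis replaces the condition `c > 0`: it
forces `u n * lam ^ n` to tend to zero. -/
theorem exists_strictAntiOn_rootRatio {u : ℕ → ℕ} (hu : ∀ n, 0 < u n) {lam c C : ℝ}
    (hlam : 0 < lam) (hC : 0 ≤ C)
    (hexp : ∀ n : ℕ, |(u n : ℝ) / u (n + 1) - (lam + c / ((n : ℝ) + 1))| ≤ C / ((n : ℝ) + 1) ^ 2)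
    (hdouble : ∀ M : ℝ, ∀ᶠ n in atTop, M * (u n : ℝ) ^ 2 ≤ u (2 * n)) :
    ∃ N : ℕ, 1 ≤ N ∧ StrictAntiOn (rootRatio u) (Set.Ici N) := by
  have hpos : ∀ k, (0 : ℝ) < u k := fun k => by exact_mod_cast hu k
  set e : ℕ → ℝ := fun n => (u n : ℝ) / u (n + 1) with he
  have hepos : ∀ n, 0 < e n := fun n => div_pos (hpos _) (hpos _)
  set l : ℕ → ℝ := fun n => Real.log (u n) + n * Real.log lam with hl
  have hdiff : ∀ n, l (n + 1) - l n = Real.log lam - Real.log (e n) := by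
    intro n
    simp only [hl, he]
    rw [Real.log_div (hpos _).ne' (hpos _).ne']
    push_cast; ring
  have hbd : ∀ n : ℕ, |e n - lam| ≤ (|c| + C) / ((n : ℝ) + 1) := by
    intro n
    have h0 : (0 : ℝ) < (n : ℝ) + 1 := by positivity
    have h1 : C / ((n : ℝ) + 1) ^ 2 ≤ C / ((n : ℝ) + 1) := by
      gcongr
      exact le_self_pow₀ (by linarith [Nat.cast_nonneg (α := ℝ) n]) two_ne_zero
    calc |e n - lam| = |(e n - (lam + c / ((n : ℝ) + 1))) + c / ((n : ℝ) + 1)| := by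
          congr 1; ring
      _ ≤ C / ((n : ℝ) + 1) + |c| / ((n : ℝ) + 1) := by
          refine (abs_add_le _ _).trans (add_le_add ((hexp n).trans h1) (le_of_eq ?_))
          rw [abs_div, abs_of_pos h0]
      _ = _ := by ring
  have helim : Tendsto e atTop (𝓝 lam) := by
    rw [tendsto_iff_dist_tendsto_zero]
    refine squeeze_zero (fun _ => dist_nonneg) hbd
      (tendsto_const_nhds.div_atTop
        (tendsto_atTop_add_const_right _ _ tendsto_natCast_atTop_atTop))
  have hslope : Tendsto (fun n => l (n + 1) - l n) atTop (𝓝 0) := by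
    simp only [hdiff]
    have := (tendsto_const_nhds (x := Real.log lam)).sub (helim.log hlam.ne')
    rwa [sub_self] at this
  have hbot : Tendsto l atTop atBot := by
    refine tendsto_atBot_of_doubling hslope fun M => ?_
    filter_upwards [hdouble (Real.exp M)] with n hn
    have := Real.log_le_log (by have := hpos n; positivity) hn
    rw [Real.log_mul (Real.exp_ne_zero _) (by have := hpos n; positivity), Real.log_exp,
      Real.log_pow] at this
    simp only [hl]
    push_cast at this ⊢
    linarith
  have h1 : ∀ᶠ n : ℕ in atTop, -((|c| + C) / lam) ≤ n * (l (n + 1) - l n) := by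
    refine Eventually.of_forall fun n => ?_
    have h0 : (0 : ℝ) < (n : ℝ) + 1 := by positivity
    have hlog : Real.log (e n) - Real.log lam ≤ e n / lam - 1 := by
      rw [← Real.log_div (hepos n).ne' hlam.ne']
      exact Real.log_le_sub_one_of_pos (div_pos (hepos n) hlam)
    have h3 : e n / lam - 1 ≤ ((|c| + C) / lam) / ((n : ℝ) + 1) := by
      rw [div_sub_one hlam.ne', div_right_comm]
      gcongr
      exact (le_abs_self _).trans (hbd n)
    have h4 : (n : ℝ) * (((|c| + C) / lam) / ((n : ℝ) + 1)) ≤ (|c| + C) / lam := by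
      have : 0 ≤ (|c| + C) / lam := by positivity
      rw [← mul_div_assoc, div_le_iff₀ h0]
      nlinarith
    have h5 := mul_le_mul_of_nonneg_left (hlog.trans h3) (Nat.cast_nonneg (α := ℝ) n)
    rw [hdiff]
    linarith
  have h2 : ∀ᶠ n : ℕ in atTop, n * (n + 1) * (l (n + 2) - 2 * l (n + 1) + l n)
      ≤ (|c| + 2 * C) / (lam / 2) := by
    have hev : ∀ᶠ n in atTop, lam / 2 < e (n + 1) :=
      (helim.comp (tendsto_add_atTop_nat 1)).eventually_const_lt (half_lt_self hlam)
    filter_upwards [hev] with n hn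
    have h0 : (0 : ℝ) < (n : ℝ) + 1 := by positivity
    have e1 := abs_le.1 (hexp n)
    have e2 := abs_le.1 (hexp (n + 1))
    push_cast at e2
    have hsq : C / ((n : ℝ) + 1 + 1) ^ 2 ≤ C / ((n : ℝ) + 1) ^ 2 := by gcongr; linarith
    have hc : c / ((n : ℝ) + 1) - c / ((n : ℝ) + 1 + 1) ≤ |c| / ((n : ℝ) + 1) ^ 2 := by
      have : c / ((n : ℝ) + 1) - c / ((n : ℝ) + 1 + 1)
          = c / (((n : ℝ) + 1) * ((n : ℝ) + 1 + 1)) := by field_simp; ring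
      rw [this]
      gcongr
      · exact le_abs_self c
      · nlinarith
    have hE : e n - e (n + 1) ≤ (|c| + 2 * C) / ((n : ℝ) + 1) ^ 2 := by
      have : (|c| + 2 * C) / ((n : ℝ) + 1) ^ 2
        = |c| / ((n : ℝ) + 1) ^ 2 + C / ((n : ℝ) + 1) ^ 2 + C / ((n : ℝ) + 1) ^ 2 := by ring
      rw [this]
      simp only [he] at *
      linarith [e1.2, e2.1]
    have hlog : l (n + 2) - 2 * l (n + 1) + l n ≤ (e n - e (n + 1)) / e (n + 1) := by
      have a1 := hdiff n
      have a2 := hdiff (n + 1)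
      have a3 := Real.log_le_sub_one_of_pos (div_pos (hepos n) (hepos (n + 1)))
      rw [Real.log_div (hepos _).ne' (hepos _).ne', div_sub_one (hepos _).ne'] at a3
      rw [show n + 1 + 1 = n + 2 from rfl] at a2
      linarith
    have hfin : (e n - e (n + 1)) / e (n + 1)
        ≤ ((|c| + 2 * C) / (lam / 2)) / ((n : ℝ) + 1) ^ 2 := by
      rw [div_right_comm]
      calc _ ≤ ((|c| + 2 * C) / ((n : ℝ) + 1) ^ 2) / e (n + 1) := by
            have := hepos (n + 1); gcongr
        _ ≤ _ := by gcongr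
    have hnn : (0 : ℝ) ≤ n * (n + 1) := by positivity
    refine (mul_le_mul_of_nonneg_left (hlog.trans hfin) hnn).trans ?_
    have : 0 ≤ (|c| + 2 * C) / (lam / 2) := by positivity
    rw [← mul_div_assoc, div_le_iff₀ (by positivity)]
    nlinarith
  obtain ⟨N, hN⟩ := eventually_atTop.1 (eventually_div_second_difference_neg hbot h1 h2)
  refine ⟨max N 1, le_max_right _ _, strictAntiOn_of_succ_lt Set.ordConnected_Ici ?_⟩
  intro n _ hn _
  have hnN : N ≤ n := (le_max_left N 1).trans hn
  have hn0 : (0 : ℝ) < n := by exact_mod_cast (le_max_right N 1).trans hn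
  rw [Order.succ_eq_add_one, rootRatio_eq_exp hu, rootRatio_eq_exp hu, Real.exp_lt_exp]
  have := hN n hnN
  simp only [hl] at this
  push_cast at this ⊢
  -- The linear term `n * log lam` of `l` does not contribute to the second difference of `l n / n`.
  have key : ∀ x t : ℝ, 0 < t → (x + t * Real.log lam) / t = x / t + Real.log lam :=
    fun x t ht => by field_simp
  rw [key _ _ hn0, key _ _ (by positivity), key _ _ (by positivity)] at this
  rw [show (n : ℝ) + 1 + 1 = n + 2 by ring]
  linarith

/-! ### The recurrence of the summands in `k` -/

/-- The summand `C(n,k)^{r_0} C(n+k,k)^{r_1} ⋯ C(n+km,k)^{r_m}` of `binomSum r n`. -/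
def binomTerm {m : ℕ} (r : Fin (m + 1) → ℕ) (n k : ℕ) : ℕ :=
  ∏ j : Fin (m + 1), (n + k * (j : ℕ)).choose k ^ r j

theorem binomSum_eq_sum_binomTerm {m : ℕ} (r : Fin (m + 1) → ℕ) (n : ℕ) :
    binomSum r n = ∑ k ∈ range (n + 1), binomTerm r n k := rfl

theorem binomTerm_pos {m : ℕ} (r : Fin (m + 1) → ℕ) {n k : ℕ} (hk : k ≤ n) :
    0 < binomTerm r n k :=
  Finset.prod_pos fun _ _ => pow_pos (Nat.choose_pos (hk.trans (Nat.le_add_right _ _))) _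

theorem binomSum_pos {m : ℕ} (r : Fin (m + 1) → ℕ) (n : ℕ) : 0 < binomSum r n := by
  rw [binomSum_eq_sum_binomTerm]
  exact Finset.sum_pos (fun k hk => binomTerm_pos r (Nat.lt_succ_iff.1 (mem_range.1 hk))) (by simp)

theorem choose_succ_mul_ascFactorial (p k i : ℕ) :
    (p + k + (i + 1)).choose (k + 1) * (k + 1) * (p + 1).ascFactorial i
      = (p + k).choose k * (p + k + 1).ascFactorial (i + 1) := by
  have h1 := Nat.add_choose_mul_factorial_mul_factorial (p + i) (k + 1)
  have h2 := Nat.add_choose_mul_factorial_mul_factorial p k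
  have h3 := Nat.factorial_mul_ascFactorial p i
  have h4 := Nat.factorial_mul_ascFactorial (p + k) (i + 1)
  have e1 : p + i + (k + 1) = p + k + (i + 1) := by ring
  rw [e1] at h1
  rw [Nat.factorial_succ k] at h1
  refine Nat.eq_of_mul_eq_mul_left (Nat.mul_pos (Nat.factorial_pos p) (Nat.factorial_pos k)) ?_
  calc _ = (p + k + (i + 1)).choose (k + 1) * (p.factorial * (p + 1).ascFactorial i)
        * ((k + 1) * k.factorial) := by ring
    _ = (p + k).factorial * (p + k + 1).ascFactorial (i + 1) := by rw [h3, h1, h4]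
    _ = _ := by rw [← h2]; ring

theorem cast_ascFactorial_succ (p i : ℕ) :
    ((p + 1).ascFactorial i : ℝ) = ∏ l ∈ range i, ((p : ℝ) + (l + 1)) := by
  rw [Nat.ascFactorial_eq_prod_range]
  push_cast
  exact prod_congr rfl fun l _ => by ring

/-- The factor of `steinA` coming from `C(n + k (i + 1), k)`. -/
noncomputable def factorA (i n : ℕ) (x : ℝ) : ℝ :=
  ∏ l ∈ range (i + 1), (1 + ((i : ℝ) + 1) * x + ((l : ℝ) + 1) / n)

/-- The factor of `steinB` coming from `C(n + k (i + 1), k)`. -/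
noncomputable def factorB (i n : ℕ) (x : ℝ) : ℝ :=
  x * ∏ l ∈ range i, (1 + (i : ℝ) * x + ((l : ℝ) + 1 - i) / n)

/-- The recurrence in `k` of a single binomial factor, divided by `n ^ (i + 1)`. -/
theorem choose_mul_factorB (i : ℕ) {n : ℕ} (hn : 1 ≤ n) (k : ℕ) :
    ((n + (k + 1) * (i + 1)).choose (k + 1) : ℝ) * factorB i n (((k + 1 : ℕ) : ℝ) / n)
      = ((n + k * (i + 1)).choose k : ℝ) * factorA i n ((k : ℝ) / n) := by
  have hn0 : (n : ℝ) ≠ 0 := by positivity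
  have h := choose_succ_mul_ascFactorial (n + k * i) k i
  have e1 : n + k * i + k + (i + 1) = n + (k + 1) * (i + 1) := by ring
  have e2 : n + k * i + k = n + k * (i + 1) := by ring
  rw [e1, e2] at h
  have h' := congrArg (Nat.cast : ℕ → ℝ) h
  rw [Nat.cast_mul, Nat.cast_mul, Nat.cast_mul, cast_ascFactorial_succ,
    cast_ascFactorial_succ] at h'
  have eA : factorA i n ((k : ℝ) / n) * (n : ℝ) ^ (i + 1)
      = ∏ l ∈ range (i + 1), (((n + k * (i + 1) : ℕ) : ℝ) + (l + 1)) := by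
    rw [factorA]
    rw [show (n : ℝ) ^ (i + 1) = ∏ l ∈ range (i + 1), (n : ℝ) by simp, ← prod_mul_distrib]
    refine prod_congr rfl fun l _ => ?_
    push_cast; field_simp
  have eB : factorB i n (((k + 1 : ℕ) : ℝ) / n) * (n : ℝ) ^ (i + 1)
      = ((k + 1 : ℕ) : ℝ) * ∏ l ∈ range i, (((n + k * i : ℕ) : ℝ) + (l + 1)) := by
    have : ∏ l ∈ range i, (((n + k * i : ℕ) : ℝ) + (l + 1))
        = (∏ l ∈ range i, (1 + (i : ℝ) * (((k + 1 : ℕ) : ℝ) / n) + ((l : ℝ) + 1 - i) / n))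
          * (n : ℝ) ^ i := by
      rw [show (n : ℝ) ^ i = ∏ l ∈ range i, (n : ℝ) by simp, ← prod_mul_distrib]
      refine prod_congr rfl fun l _ => ?_
      push_cast; field_simp; ring
    rw [this, factorB, pow_succ]
    field_simp
  refine mul_right_cancel₀ (pow_ne_zero (i + 1) hn0) ?_
  rw [mul_assoc, eB, mul_assoc, eA, ← h']
  ring

/-- The coefficient of `T(n, k)` in the recurrence of the summands in `k`, as a function of
`x = k / n`. -/
noncomputable def steinA {m : ℕ} (r : Fin (m + 1) → ℕ) (n : ℕ) (x : ℝ) : ℝ :=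
  (1 - x) ^ r 0 * ∏ i : Fin m, factorA i n x ^ r i.succ

/-- The coefficient of `T(n, k)` in the recurrence relating it to `T(n, k - 1)`, as a function of
`x = k / n`. -/
noncomputable def steinB {m : ℕ} (r : Fin (m + 1) → ℕ) (n : ℕ) (x : ℝ) : ℝ :=
  x ^ r 0 * ∏ i : Fin m, factorB i n x ^ r i.succ

theorem binomTerm_succ_mul_steinB {m : ℕ} (r : Fin (m + 1) → ℕ) {n k : ℕ} (hn : 1 ≤ n)
    (hk : k ≤ n) :
    (binomTerm r n (k + 1) : ℝ) * steinB r n (((k + 1 : ℕ) : ℝ) / n)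
      = binomTerm r n k * steinA r n ((k : ℝ) / n) := by
  have hn0 : (n : ℝ) ≠ 0 := by positivity
  have h0 : (n.choose (k + 1) : ℝ) * (((k + 1 : ℕ) : ℝ) / n) = n.choose k * (1 - (k : ℝ) / n) := by
    have := congrArg (Nat.cast : ℕ → ℝ) (Nat.choose_succ_right_eq n k)
    rw [Nat.cast_mul, Nat.cast_mul, Nat.cast_sub hk] at this
    field_simp
    exact this
  simp only [binomTerm, steinA, steinB, Fin.prod_univ_succ, Fin.val_zero, Fin.val_succ, mul_zero,
    add_zero]
  push_cast
  rw [mul_mul_mul_comm, mul_mul_mul_comm ((n.choose k : ℝ) ^ r 0), ← mul_pow, ← mul_pow,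
    ← prod_mul_distrib, ← prod_mul_distrib]
  congr 1
  · rw [← h0]; push_cast; rfl
  · refine prod_congr rfl fun i _ => ?_
    rw [← mul_pow, ← mul_pow]
    have := choose_mul_factorB i hn k
    push_cast at this
    rw [this]

/-- Summation by parts: no boundary terms appear, as `steinA r n 1 = 0 = steinB r n 0` when
`r 0 > 0`. -/
theorem sum_binomTerm_stein {m : ℕ} {r : Fin (m + 1) → ℕ} (hr : 0 < r 0) {n : ℕ} (hn : 1 ≤ n)
    (H : ℝ → ℝ) :
    ∑ k ∈ range (n + 1), (binomTerm r n k : ℝ)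
      * (H (k / n) * steinA r n (k / n) - H (k / n - 1 / n) * steinB r n (k / n)) = 0 := by
  have hn0 : (n : ℝ) ≠ 0 := by positivity
  simp only [mul_sub, sum_sub_distrib]
  rw [sum_range_succ, sum_range_succ' (fun k => (binomTerm r n k : ℝ)
    * (H (k / n - 1 / n) * steinB r n (k / n)))]
  have hA : steinA r n ((n : ℝ) / n) = 0 := by simp [steinA, div_self hn0, hr.ne']
  have hB : steinB r n (((0 : ℕ) : ℝ) / n) = 0 := by simp [steinB, hr.ne']
  rw [hA, hB, mul_zero, mul_zero, mul_zero, mul_zero, add_zero, add_zero, ← sum_sub_distrib]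
  refine sum_eq_zero fun k hk => ?_
  have h := binomTerm_succ_mul_steinB r hn (mem_range.1 hk).le
  have hx : (((k + 1 : ℕ) : ℝ) / n - 1 / n) = (k : ℝ) / n := by push_cast; ring
  rw [hx, mul_left_comm, mul_left_comm _ (H _), h, sub_self]

/-! ### The concentration point -/

/-- The leading coefficient of `steinA` as `n → ∞`. -/
noncomputable def leadA {m : ℕ} (r : Fin (m + 1) → ℕ) (x : ℝ) : ℝ :=
  (1 - x) ^ r 0 * ∏ i : Fin m, ((1 + ((i : ℝ) + 1) * x) ^ ((i : ℕ) + 1)) ^ r i.succ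

/-- The leading coefficient of `steinB` as `n → ∞`. -/
noncomputable def leadB {m : ℕ} (r : Fin (m + 1) → ℕ) (x : ℝ) : ℝ :=
  x ^ r 0 * ∏ i : Fin m, (x * (1 + (i : ℝ) * x) ^ (i : ℕ)) ^ r i.succ

theorem hasExpansion_factorA (i : ℕ) :
    HasExpansion (factorA i) (fun x => (1 + ((i : ℝ) + 1) * x) ^ (i + 1)) := by
  have h := HasExpansion.prod (range (i + 1))
    (a := fun (l : ℕ) n x => 1 + ((i : ℝ) + 1) * x + ((l : ℝ) + 1) / n)
    (a₀ := fun _ x => 1 + ((i : ℝ) + 1) * x) fun l _ => HasExpansion.linear _ _ _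
  simp only [prod_const, card_range] at h
  exact h

theorem hasExpansion_factorB (i : ℕ) :
    HasExpansion (factorB i) (fun x => x * (1 + (i : ℝ) * x) ^ i) := by
  have h := HasExpansion.prod (range i)
    (a := fun (l : ℕ) n x => 1 + (i : ℝ) * x + ((l : ℝ) + 1 - i) / n)
    (a₀ := fun _ x => 1 + (i : ℝ) * x) fun l _ => HasExpansion.linear _ _ _
  have h' := (HasExpansion.linear 0 1 0).mul h
  simp only [prod_const, card_range, zero_add, one_mul, zero_div, add_zero] at h'
  exact h'

theorem hasExpansion_steinA {m : ℕ} (r : Fin (m + 1) → ℕ) :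
    HasExpansion (steinA r) (leadA r) := by
  have h1 := (HasExpansion.linear 1 (-1) 0).pow (r 0)
  have h2 := HasExpansion.prod (univ : Finset (Fin m))
    (a := fun (i : Fin m) n x => factorA i n x ^ r i.succ)
    fun i _ => (hasExpansion_factorA i).pow (r i.succ)
  have h := h1.mul h2
  simp only [neg_mul, one_mul, zero_div, add_zero, ← sub_eq_add_neg] at h
  exact h

theorem hasExpansion_steinB {m : ℕ} (r : Fin (m + 1) → ℕ) :
    HasExpansion (steinB r) (leadB r) := by
  have h1 := (HasExpansion.linear 0 1 0).pow (r 0)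
  have h2 := HasExpansion.prod (univ : Finset (Fin m))
    (a := fun (i : Fin m) n x => factorB i n x ^ r i.succ)
    fun i _ => (hasExpansion_factorB i).pow (r i.succ)
  have h := h1.mul h2
  simp only [zero_add, one_mul, zero_div, add_zero] at h
  exact h

/-- `log (leadA r x) - log (leadB r x)`, expanded into logarithms of linear factors. -/
noncomputable def logLeadRatio {m : ℕ} (r : Fin (m + 1) → ℕ) (x : ℝ) : ℝ :=
  r 0 * (Real.log (1 - x) - Real.log x)
    + ∑ i : Fin m, r i.succ * ((((i : ℝ) + 1) * Real.log (1 + ((i : ℝ) + 1) * x))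
      - (Real.log x + (i : ℝ) * Real.log (1 + (i : ℝ) * x)))

theorem leadA_pos {m : ℕ} (r : Fin (m + 1) → ℕ) {x : ℝ} (h0 : 0 < x) (h1 : x < 1) :
    0 < leadA r x := by
  refine mul_pos (pow_pos (by linarith) _) (Finset.prod_pos fun i _ => ?_)
  positivity

theorem leadB_pos {m : ℕ} (r : Fin (m + 1) → ℕ) {x : ℝ} (h0 : 0 < x) : 0 < leadB r x := by
  refine mul_pos (pow_pos h0 _) (Finset.prod_pos fun i _ => ?_)
  positivity

theorem log_leadA_sub_log_leadB {m : ℕ} (r : Fin (m + 1) → ℕ) {x : ℝ} (h0 : 0 < x) (h1 : x < 1) :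
    Real.log (leadA r x) - Real.log (leadB r x) = logLeadRatio r x := by
  have h1' : 1 - x ≠ 0 := by linarith
  have hp : ∀ i : Fin m, 1 + ((i : ℝ) + 1) * x ≠ 0 := fun i => by positivity
  have hq : ∀ i : Fin m, 1 + (i : ℝ) * x ≠ 0 := fun i => by positivity
  rw [leadA, leadB, Real.log_mul (pow_ne_zero _ h1')
    (prod_ne_zero_iff.2 fun i _ => pow_ne_zero _ (pow_ne_zero _ (hp i))),
    Real.log_mul (pow_ne_zero _ h0.ne')
    (prod_ne_zero_iff.2 fun i _ => pow_ne_zero _ (mul_ne_zero h0.ne' (pow_ne_zero _ (hq i)))),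
    Real.log_prod fun i _ => pow_ne_zero _ (pow_ne_zero _ (hp i)),
    Real.log_prod fun i _ => pow_ne_zero _ (mul_ne_zero h0.ne' (pow_ne_zero _ (hq i)))]
  simp only [Real.log_pow]
  have : ∀ i : Fin m, Real.log (x * (1 + (i : ℝ) * x) ^ (i : ℕ))
      = Real.log x + i * Real.log (1 + (i : ℝ) * x) := fun i => by
    rw [Real.log_mul h0.ne' (pow_ne_zero _ (hq i)), Real.log_pow]
  simp only [this, logLeadRatio, mul_sub, sum_sub_distrib]
  push_cast
  ring

theorem exists_hasDerivAt_logLeadRatio_neg {m : ℕ} {r : Fin (m + 1) → ℕ} (hr : 0 < r 0) {x : ℝ}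
    (h0 : 0 < x) (h1 : x < 1) : ∃ D < 0, HasDerivAt (logLeadRatio r) D x := by
  have h1' : 0 < 1 - x := by linarith
  have hlin : ∀ t : ℝ, 0 ≤ t → HasDerivAt (fun y => Real.log (1 + t * y)) (t / (1 + t * x)) x := by
    intro t ht
    have h : HasDerivAt (fun y : ℝ => 1 + t * y) t x := by
      simpa using ((hasDerivAt_id x).const_mul t).const_add 1
    exact h.log (by positivity)
  have hsub : HasDerivAt (fun y : ℝ => Real.log (1 - y)) (-1 / (1 - x)) x :=
    ((hasDerivAt_id x).const_sub 1).log h1'.ne'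
  have hlog := Real.hasDerivAt_log h0.ne'
  have hfirst := (hsub.sub hlog).const_mul (r 0 : ℝ)
  have hterm : ∀ i ∈ (univ : Finset (Fin m)), HasDerivAt
      (fun y => (r i.succ : ℝ) * ((((i : ℝ) + 1) * Real.log (1 + ((i : ℝ) + 1) * y))
        - (Real.log y + (i : ℝ) * Real.log (1 + (i : ℝ) * y))))
      ((r i.succ : ℝ) * ((((i : ℝ) + 1) * (((i : ℝ) + 1) / (1 + ((i : ℝ) + 1) * x)))
        - (x⁻¹ + (i : ℝ) * ((i : ℝ) / (1 + (i : ℝ) * x))))) x := fun i _ =>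
    (((hlin _ (by positivity)).const_mul _).sub
      (hlog.add ((hlin _ (by positivity)).const_mul _))).const_mul _
  refine ⟨_, ?_, hfirst.add (HasDerivAt.fun_sum hterm)⟩
  refine add_neg_of_neg_of_nonpos ?_ (sum_nonpos fun i _ => ?_)
  · refine mul_neg_of_pos_of_neg (by exact_mod_cast hr) ?_
    have : 0 < 1 / (1 - x) := by positivity
    have : 0 < x⁻¹ := by positivity
    rw [neg_div]; linarith
  · refine mul_nonpos_of_nonneg_of_nonpos (by positivity) ?_
    have : ((i : ℝ) + 1) * (((i : ℝ) + 1) / (1 + ((i : ℝ) + 1) * x))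
        - (x⁻¹ + (i : ℝ) * ((i : ℝ) / (1 + (i : ℝ) * x)))
        = -(1 / (x * (1 + ((i : ℝ) + 1) * x) * (1 + (i : ℝ) * x))) := by
      field_simp; ring
    rw [this, neg_nonpos]
    positivity

theorem leadA_sub_leadB_ends {m : ℕ} {r : Fin (m + 1) → ℕ} (hr : 0 < r 0) :
    0 < leadA r 0 - leadB r 0 ∧ leadA r 1 - leadB r 1 < 0 := by
  constructor
  · simp [leadA, leadB, hr.ne']
  · have := leadB_pos r one_pos
    have h : leadA r 1 = 0 := by simp [leadA, hr.ne']
    linarith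

/-- The leading coefficients of the recurrence agree at exactly one point of `[0, 1]`, and their
difference has a simple zero there, because the logarithmic derivative of their quotient is
negative. -/
theorem exists_concentration_point {m : ℕ} {r : Fin (m + 1) → ℕ} (hr : 0 < r 0) :
    ∃ x₀ : ℝ, 0 < x₀ ∧ x₀ < 1 ∧ leadA r x₀ = leadB r x₀ ∧
      (∀ x ∈ Set.Icc (0 : ℝ) 1, x ≠ x₀ → leadA r x ≠ leadB r x) ∧
      deriv (fun x => leadA r x - leadB r x) x₀ ≠ 0 := by
  have hA := (hasExpansion_steinA r).1
  have hB := (hasExpansion_steinB r).1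
  obtain ⟨hs, ht⟩ := leadA_sub_leadB_ends hr
  have hne0 : ∀ x ∈ Set.Icc (0 : ℝ) 1, leadA r x = leadB r x → 0 < x ∧ x < 1 := by
    intro x hx h
    refine ⟨hx.1.lt_of_ne ?_, hx.2.lt_of_ne ?_⟩
    · rintro rfl; linarith
    · rintro rfl; linarith
  obtain ⟨x₀, hx₀, hz⟩ := intermediate_value_Icc' (zero_le_one' ℝ)
    (hA.continuousOn.sub hB.continuousOn) ⟨ht.le, hs.le⟩
  have hz' : leadA r x₀ = leadB r x₀ := sub_eq_zero.1 hz
  obtain ⟨hpos, hlt⟩ := hne0 x₀ hx₀ hz'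
  have hanti : StrictAntiOn (logLeadRatio r) (Set.Ioo 0 1) := by
    refine strictAntiOn_of_deriv_neg (convex_Ioo 0 1) ?_ ?_
    · intro x hx
      obtain ⟨D, _, hD⟩ := exists_hasDerivAt_logLeadRatio_neg hr hx.1 hx.2
      exact hD.continuousAt.continuousWithinAt
    · rw [interior_Ioo]
      intro x hx
      obtain ⟨D, hD0, hD⟩ := exists_hasDerivAt_logLeadRatio_neg hr hx.1 hx.2
      rwa [hD.deriv]
  refine ⟨x₀, hpos, hlt, hz', fun x hx hne h => hne ?_, ?_⟩
  · obtain ⟨hx0, hx1⟩ := hne0 x hx h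
    refine hanti.injOn ⟨hx0, hx1⟩ ⟨hpos, hlt⟩ ?_
    rw [← log_leadA_sub_log_leadB r hx0 hx1, ← log_leadA_sub_log_leadB r hpos hlt, h, hz',
      sub_self, sub_self]
  · obtain ⟨D, hD0, hD⟩ := exists_hasDerivAt_logLeadRatio_neg hr hpos hlt
    have dA := (hA x₀ hx₀).differentiableAt.hasDerivAt
    have dB := (hB x₀ hx₀).differentiableAt.hasDerivAt
    have hpA := leadA_pos r hpos hlt
    have hpB := leadB_pos r hpos
    have hD' : HasDerivAt (logLeadRatio r)
        (deriv (leadA r) x₀ / leadA r x₀ - deriv (leadB r) x₀ / leadB r x₀) x₀ := by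
      refine ((dA.log hpA.ne').sub (dB.log hpB.ne')).congr_of_eventuallyEq ?_
      filter_upwards [isOpen_Ioo.mem_nhds (show x₀ ∈ Set.Ioo 0 1 from ⟨hpos, hlt⟩)] with y hy
      exact (log_leadA_sub_log_leadB r hy.1 hy.2).symm
    have hDeq := hD.unique hD'
    rw [(dA.fun_sub dB).deriv]
    intro h
    rw [hz', ← sub_div, h, zero_div] at hDeq
    exact hD0.ne hDeq

/-- The summands of `binomSum r` as Stein weights concentrated at `x₀`. -/
noncomputable def binomSteinWeights {m : ℕ} {r : Fin (m + 1) → ℕ} (hr : 0 < r 0) {x₀ : ℝ}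
    (hx₀ : x₀ ∈ Set.Icc (0 : ℝ) 1) (heq : leadA r x₀ = leadB r x₀)
    (hne : ∀ x ∈ Set.Icc (0 : ℝ) 1, x ≠ x₀ → leadA r x ≠ leadB r x)
    (hderiv : deriv (fun x => leadA r x - leadB r x) x₀ ≠ 0) :
    SteinWeights (fun n k => (binomTerm r n k : ℝ)) x₀ where
  a := steinA r
  b := steinB r
  a₀ := leadA r
  b₀ := leadB r
  nonneg _ _ := Nat.cast_nonneg _
  sum_pos n := by exact_mod_cast binomSum_pos r n
  expansion_a := hasExpansion_steinA r
  expansion_b := hasExpansion_steinB r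
  b_zero n := by simp [steinB, hr.ne']
  b₀_zero := by simp [leadB, hr.ne']
  stein _ hn H := sum_binomTerm_stein hr hn H
  mem := hx₀
  eq_at := heq
  ne_of_ne := hne
  deriv_ne := hderiv

/-! ### Ratios of consecutive sums -/

/-- `T(n, k) / T(n + 1, k)` as a function of `x = k / (n + 1)`. -/
noncomputable def consecutiveRatio {m : ℕ} (r : Fin (m + 1) → ℕ) (x : ℝ) : ℝ :=
  (1 - x) ^ r 0 * ∏ i : Fin m, ((1 + (i : ℝ) * x) / (1 + ((i : ℝ) + 1) * x)) ^ r i.succ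

theorem choose_succ_mul_sub (p k : ℕ) :
    ((p + k + 1).choose k : ℝ) * (p + 1) = (p + k).choose k * (p + k + 1) := by
  have h := Nat.choose_mul_succ_eq (p + k) k
  rw [show p + k + 1 - k = p + 1 by omega] at h
  exact_mod_cast h.symm

theorem binomTerm_succ_mul_consecutiveRatio {m : ℕ} (r : Fin (m + 1) → ℕ) {n k : ℕ}
    (hk : k ≤ n + 1) :
    (binomTerm r (n + 1) k : ℝ) * consecutiveRatio r ((k : ℝ) / ((n : ℝ) + 1))
      = binomTerm r n k := by
  have hn0 : (0 : ℝ) < (n : ℝ) + 1 := by positivity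
  simp only [binomTerm, consecutiveRatio, Fin.prod_univ_succ, Fin.val_zero, Fin.val_succ, mul_zero,
    add_zero]
  push_cast
  rw [mul_mul_mul_comm, ← mul_pow, ← prod_mul_distrib]
  congr 1
  · congr 1
    have h := congrArg (Nat.cast : ℕ → ℝ) (Nat.choose_mul_succ_eq n k)
    rw [Nat.cast_mul, Nat.cast_mul, Nat.cast_sub hk] at h
    push_cast at h
    field_simp
    linarith
  · refine prod_congr rfl fun i _ => ?_
    rw [← mul_pow]
    congr 1
    have h := choose_succ_mul_sub (n + k * i) k
    rw [show n + k * (i : ℕ) + k + 1 = n + 1 + k * (i + 1) by ring,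
      show n + k * (i : ℕ) + k = n + k * (i + 1) by ring] at h
    push_cast at h
    have e : (1 + (i : ℝ) * (k / ((n : ℝ) + 1))) / (1 + ((i : ℝ) + 1) * (k / ((n : ℝ) + 1)))
        = ((n : ℝ) + k * i + 1) / (n + k * i + k + 1) := by
      field_simp
      ring
    rw [e, ← mul_div_assoc, h, mul_div_assoc, div_self (by positivity), mul_one]

theorem weightedMean_consecutiveRatio {m : ℕ} {r : Fin (m + 1) → ℕ} (hr : 0 < r 0) (n : ℕ) :
    weightedMean (fun n k => (binomTerm r n k : ℝ)) (n + 1) (consecutiveRatio r)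
      = (binomSum r n : ℝ) / binomSum r (n + 1) := by
  rw [weightedMean, binomSum_eq_sum_binomTerm, binomSum_eq_sum_binomTerm]
  push_cast
  congr 1
  rw [sum_range_succ]
  have hlast : consecutiveRatio r (((n : ℝ) + 1) / ((n : ℝ) + 1)) = 0 := by
    rw [div_self (by positivity)]
    simp [consecutiveRatio, hr.ne']
  have := hlast
  push_cast
  rw [this, mul_zero, add_zero]
  refine sum_congr rfl fun k hk => binomTerm_succ_mul_consecutiveRatio r (mem_range.1 hk).le

theorem analyticOnNhd_consecutiveRatio {m : ℕ} (r : Fin (m + 1) → ℕ) :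
    AnalyticOnNhd ℝ (consecutiveRatio r) (Set.Icc 0 1) := by
  intro x hx
  have h0 := hx.1
  have hlin : ∀ t : ℝ, AnalyticAt ℝ (fun y : ℝ => 1 + t * y) x := fun t =>
    analyticAt_const.add (analyticAt_const.mul analyticAt_id)
  refine ((analyticAt_const.sub analyticAt_id).pow _).mul ?_
  refine Finset.analyticAt_fun_prod _ fun i _ => ?_
  exact ((hlin _).div (hlin _) (by positivity)).pow _

theorem consecutiveRatio_pos {m : ℕ} (r : Fin (m + 1) → ℕ) {x : ℝ} (h0 : 0 < x) (h1 : x < 1) :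
    0 < consecutiveRatio r x := by
  refine mul_pos (pow_pos (by linarith) _) (Finset.prod_pos fun i _ => ?_)
  positivity

/-! ### Growth under doubling -/

theorem centralBinom_sq_mul_le (n : ℕ) : n.centralBinom ^ 2 * (2 * n + 1) ≤ 16 ^ n := by
  induction n with
  | zero => simp
  | succ n ih =>
    have h := Nat.succ_mul_centralBinom_succ n
    refine Nat.le_of_mul_le_mul_left ?_ (show 0 < (n + 1) ^ 2 by positivity)
    calc (n + 1) ^ 2 * ((n + 1).centralBinom ^ 2 * (2 * (n + 1) + 1))
        = ((n + 1) * (n + 1).centralBinom) ^ 2 * (2 * n + 3) := by ring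
      _ = (n.centralBinom ^ 2 * (2 * n + 1)) * (4 * ((2 * n + 1) * (2 * n + 3))) := by
          rw [h]; ring
      _ ≤ 16 ^ n * (16 * (n + 1) ^ 2) := Nat.mul_le_mul ih (by nlinarith)
      _ = _ := by ring

theorem le_mul_centralBinom_sq {n : ℕ} (hn : 1 ≤ n) : 16 ^ n ≤ 4 * n * n.centralBinom ^ 2 := by
  induction n, hn using Nat.le_induction with
  | base => simp [Nat.centralBinom]
  | succ n hn ih =>
    have h := Nat.succ_mul_centralBinom_succ n
    refine Nat.le_of_mul_le_mul_left ?_ (show 0 < n + 1 by positivity)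
    calc (n + 1) * 16 ^ (n + 1) = 16 * (n + 1) * 16 ^ n := by ring
      _ ≤ 16 * (n + 1) * (4 * n * n.centralBinom ^ 2) := by gcongr
      _ = 16 * (4 * n * (n + 1)) * n.centralBinom ^ 2 := by ring
      _ ≤ 16 * ((2 * n + 1) ^ 2) * n.centralBinom ^ 2 := by gcongr; nlinarith
      _ = 4 * (2 * (2 * n + 1) * n.centralBinom) ^ 2 := by ring
      _ = _ := by rw [← h]; ring

theorem choose_two_mul_mul_centralBinom (b c : ℕ) :
    (2 * (b + c)).choose (2 * b) * (b.centralBinom * c.centralBinom)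
      = (b + c).centralBinom * (b + c).choose b ^ 2 := by
  have hcb : ∀ n : ℕ, n.centralBinom * (n.factorial * n.factorial) = (2 * n).factorial := by
    intro n
    have := Nat.choose_mul_factorial_mul_factorial (show n ≤ 2 * n by omega)
    rw [show 2 * n - n = n by omega, mul_assoc] at this
    exact this
  have h1 := Nat.choose_mul_factorial_mul_factorial (show 2 * b ≤ 2 * (b + c) by omega)
  rw [show 2 * (b + c) - 2 * b = 2 * c by omega, ← hcb b, ← hcb c, ← hcb (b + c)] at h1
  have h2 := Nat.choose_mul_factorial_mul_factorial (show b ≤ b + c by omega)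
  rw [Nat.add_sub_cancel_left] at h2
  refine Nat.eq_of_mul_eq_mul_right
    (show 0 < (b.factorial * c.factorial) ^ 2 by positivity) ?_
  calc _ = (2 * (b + c)).choose (2 * b) * (b.centralBinom * (b.factorial * b.factorial))
        * (c.centralBinom * (c.factorial * c.factorial)) := by ring
    _ = _ := by rw [h1, ← h2]; ring

/-- Doubling both arguments of a binomial coefficient gains a factor of order
`√(b (a - b) / a)` over squaring it, where `a = b + c`. -/
theorem mul_choose_pow_four_le (b c : ℕ) :
    b * c * (b + c).choose b ^ 4 ≤ (b + c) * (2 * (b + c)).choose (2 * b) ^ 2 := by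
  rcases Nat.eq_zero_or_pos (b + c) with h0 | h0
  · obtain ⟨rfl, rfl⟩ : b = 0 ∧ c = 0 := by omega
    simp
  have hb := centralBinom_sq_mul_le b
  have hc := centralBinom_sq_mul_le c
  have ha := le_mul_centralBinom_sq h0
  have hid := choose_two_mul_mul_centralBinom b c
  set X := b.centralBinom ^ 2 * c.centralBinom ^ 2 with hX
  have hXpos : 0 < X := by
    have := b.centralBinom_pos; have := c.centralBinom_pos; positivity
  have hX' : X * ((2 * b + 1) * (2 * c + 1)) ≤ 4 * (b + c) * (b + c).centralBinom ^ 2 := by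
    calc X * ((2 * b + 1) * (2 * c + 1))
        = (b.centralBinom ^ 2 * (2 * b + 1)) * (c.centralBinom ^ 2 * (2 * c + 1)) := by
          rw [hX]; ring
      _ ≤ 16 ^ b * 16 ^ c := Nat.mul_le_mul hb hc
      _ = 16 ^ (b + c) := (pow_add _ _ _).symm
      _ ≤ _ := ha
  refine Nat.le_of_mul_le_mul_left ?_ (show 0 < 4 * X by positivity)
  calc 4 * X * (b * c * (b + c).choose b ^ 4)
      = X * ((2 * b) * (2 * c)) * (b + c).choose b ^ 4 := by ring
    _ ≤ X * ((2 * b + 1) * (2 * c + 1)) * (b + c).choose b ^ 4 := by gcongr <;> omega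
    _ ≤ 4 * (b + c) * (b + c).centralBinom ^ 2 * (b + c).choose b ^ 4 := by gcongr
    _ = 4 * (b + c) * ((b + c).centralBinom * (b + c).choose b ^ 2) ^ 2 := by ring
    _ = _ := by rw [← hid, hX]; ring

/-- Away from the ends of the range of summation, and as there are at least two binomial factors,
doubling gains a factor of order `n`. -/
theorem mul_binomTerm_sq_le {m : ℕ} {r : Fin (m + 1) → ℕ} (hR : 1 < ∑ j, r j) {δ : ℝ} (hδ : 0 < δ)
    {n k : ℕ} (hk : δ * n ≤ k) (hk' : (k : ℝ) ≤ (1 - δ) * n)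
    (hn1 : 1 ≤ δ ^ 2 / (m + 1) * n) :
    δ ^ 2 / (m + 1) * n * (binomTerm r n k : ℝ) ^ 2 ≤ binomTerm r (2 * n) (2 * k) := by
  have hm : (0 : ℝ) < (m : ℝ) + 1 := by positivity
  have hn0 : (0 : ℝ) < n := by
    refine (Nat.cast_nonneg n).lt_of_ne fun h => ?_
    rw [← h, mul_zero] at hn1; linarith
  have hkn : k ≤ n := by
    have : (k : ℝ) ≤ n := hk'.trans (by nlinarith)
    exact_mod_cast this
  set g : ℝ := δ ^ 2 / (m + 1) * n with hg
  have hfac : ∀ j : Fin (m + 1), g * (((n + k * j).choose k : ℕ) : ℝ) ^ 4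
      ≤ (((2 * n + 2 * k * j).choose (2 * k) : ℕ) : ℝ) ^ 2 := by
    intro j
    obtain ⟨c, hc⟩ : ∃ c, n + k * (j : ℕ) = k + c :=
      Nat.exists_eq_add_of_le (hkn.trans (Nat.le_add_right _ _))
    have hcge : δ * n ≤ c := by
      have h1 : n ≤ k + c := hc ▸ Nat.le_add_right n (k * j)
      have h2 : (n : ℝ) ≤ k + c := by exact_mod_cast h1
      linarith
    have hsum : ((k + c : ℕ) : ℝ) ≤ (m + 1) * n := by
      have hj : (j : ℕ) ≤ m := Nat.lt_succ_iff.1 j.2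
      have : k + c ≤ (m + 1) * n := by
        rw [← hc]
        calc n + k * (j : ℕ) ≤ n + n * m := by gcongr
          _ = _ := by ring
      exact_mod_cast this
    have h := mul_choose_pow_four_le k c
    rw [show 2 * n + 2 * k * (j : ℕ) = 2 * (n + k * j) by ring, hc]
    have h' : (k : ℝ) * c * ((k + c).choose k : ℝ) ^ 4
        ≤ ((k + c : ℕ) : ℝ) * ((2 * (k + c)).choose (2 * k) : ℝ) ^ 2 := by exact_mod_cast h
    have h3 : g * ((m + 1) * n) ≤ k * c := by
      calc g * ((m + 1) * n) = (δ * n) * (δ * n) := by rw [hg]; field_simp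
        _ ≤ k * c := by gcongr
    refine le_of_mul_le_mul_left ?_ (show (0 : ℝ) < (m + 1) * n by positivity)
    calc (m + 1) * n * (g * ((k + c).choose k : ℝ) ^ 4)
        = g * ((m + 1) * n) * ((k + c).choose k : ℝ) ^ 4 := by ring
      _ ≤ k * c * ((k + c).choose k : ℝ) ^ 4 := by gcongr
      _ ≤ _ := h'
      _ ≤ _ := by gcongr
  have hprod : g ^ (∑ j, r j) * (binomTerm r n k : ℝ) ^ 4
      ≤ (binomTerm r (2 * n) (2 * k) : ℝ) ^ 2 := by
    simp only [binomTerm]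
    push_cast
    rw [← prod_pow, ← prod_pow, ← prod_pow_eq_pow_sum, ← prod_mul_distrib]
    refine prod_le_prod (fun j _ => by positivity) fun j _ => ?_
    calc g ^ r j * (((n + k * j).choose k : ℝ) ^ r j) ^ 4
        = (g * ((n + k * j).choose k : ℝ) ^ 4) ^ r j := by rw [mul_pow]; ring
      _ ≤ (((2 * n + 2 * k * j).choose (2 * k) : ℝ) ^ 2) ^ r j := by
          gcongr
          exact hfac j
      _ = _ := by ring
  refine le_of_sq_le_sq ?_ (by positivity)
  calc (g * (binomTerm r n k : ℝ) ^ 2) ^ 2 = g ^ 2 * (binomTerm r n k : ℝ) ^ 4 := by ring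
    _ ≤ g ^ (∑ j, r j) * (binomTerm r n k : ℝ) ^ 4 := by
        gcongr ?_ * _
        exact pow_le_pow_right₀ hn1 hR
    _ ≤ _ := hprod

/-- The indices `k ≤ n` with `k / n` within `ε` of `x₀`. -/
noncomputable def window (n : ℕ) (x₀ ε : ℝ) : Finset ℕ :=
  (range (n + 1)).filter fun k => |(k : ℝ) / n - x₀| ≤ ε

theorem card_window_le (n : ℕ) (hn : 1 ≤ n) (x₀ : ℝ) {ε : ℝ} (hε : 0 < ε)
    (hx₀ : 0 ≤ x₀ - ε) :
    ((#(window n x₀ ε) : ℕ) : ℝ) ≤ 2 * ε * n + 1 := by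
  have hn0 : (0 : ℝ) < n := by exact_mod_cast hn
  have hsub : window n x₀ ε
      ⊆ Finset.Icc ⌈(x₀ - ε) * n⌉₊ ⌊(x₀ + ε) * n⌋₊ := by
    intro k hk
    have h := abs_le.1 (mem_filter.1 hk).2
    have e : (k : ℝ) = k / n * n := by field_simp
    rw [Finset.mem_Icc]
    refine ⟨Nat.ceil_le.2 ?_, Nat.le_floor ?_⟩
    · rw [e]; gcongr; linarith
    · rw [e]; gcongr; linarith
  refine (Nat.cast_le.2 (card_le_card hsub)).trans ?_
  rw [Nat.card_Icc]
  rcases le_total ⌈(x₀ - ε) * n⌉₊ (⌊(x₀ + ε) * n⌋₊ + 1) with h | h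
  · rw [Nat.cast_sub h]
    push_cast
    have h1 := Nat.floor_le (show 0 ≤ (x₀ + ε) * n by
      have : 0 ≤ x₀ + ε := by linarith
      positivity)
    have h2 := Nat.le_ceil ((x₀ - ε) * n)
    linarith
  · rw [Nat.sub_eq_zero_of_le h]
    push_cast
    positivity

/-- The weights with `k / n` near the concentration point carry at least half of the total, as the
second moment of `k / n - x₀` is `O(1 / n)`. -/
theorem SteinWeights.eventually_half_le_sum_window {w : ℕ → ℕ → ℝ} {x₀ : ℝ} (h : SteinWeights w x₀)
    {ε : ℝ} (hε : 0 < ε) : ∀ᶠ n : ℕ in atTop, (∑ k ∈ range (n + 1), w n k) / 2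
      ≤ ∑ k ∈ window n x₀ ε, w n k := by
  have han : AnalyticOnNhd ℝ (fun x : ℝ => (x - x₀) ^ 2) (Set.Icc 0 1) :=
    (analyticOnNhd_id.sub analyticOnNhd_const).pow 2
  obtain ⟨c, C, hC, hcC⟩ := h.exists_mean_expansion han
  have hlarge := (tendsto_natCast_atTop_atTop (R := ℝ)).eventually_ge_atTop (2 * (|c| + C) / ε ^ 2)
  filter_upwards [eventually_ge_atTop 1, hlarge] with n hn hnlarge
  have hn1 : (1 : ℝ) ≤ n := by exact_mod_cast hn
  have hn0 : (0 : ℝ) < n := by linarith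
  have hS := h.sum_pos n
  set S := ∑ k ∈ range (n + 1), w n k with hSdef
  have hmom : ∑ k ∈ range (n + 1), w n k * ((k : ℝ) / n - x₀) ^ 2 ≤ ε ^ 2 / 2 * S := by
    have h1 := (abs_le.1 (hcC n hn)).2
    rw [sub_self, zero_pow two_ne_zero, zero_add] at h1
    have h2 : C / (n : ℝ) ^ 2 ≤ C / n := by gcongr; exact le_self_pow₀ hn1 two_ne_zero
    have h3 : c / n ≤ |c| / n := by gcongr; exact le_abs_self c
    have h4 : weightedMean w n (fun x => (x - x₀) ^ 2) ≤ ε ^ 2 / 2 := by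
      have h5 : (|c| + C) / n ≤ ε ^ 2 / 2 := by
        rw [div_le_iff₀ (by positivity)] at hnlarge
        rw [div_le_iff₀ hn0]; linarith
      rw [add_div] at h5
      linarith
    rw [weightedMean, div_le_iff₀ hS] at h4
    exact h4
  have hout : ε ^ 2 * ∑ k ∈ (range (n + 1)).filter fun k : ℕ => ¬|(k : ℝ) / n - x₀| ≤ ε, w n k
      ≤ ε ^ 2 / 2 * S := by
    refine le_trans ?_ hmom
    rw [mul_sum]
    refine le_trans (sum_le_sum fun k hk => ?_) (sum_le_sum_of_subset_of_nonneg
      (filter_subset (fun k : ℕ => ¬|(k : ℝ) / n - x₀| ≤ ε) _)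
      fun k _ _ => mul_nonneg (h.nonneg n k) (sq_nonneg _))
    have h1 := (not_le.1 (mem_filter.1 hk).2).le
    rw [mul_comm, ← sq_abs ((k : ℝ) / n - x₀)]
    have := h.nonneg n k
    gcongr
  have hsplit := sum_filter_add_sum_filter_not (range (n + 1))
    (fun k : ℕ => |(k : ℝ) / n - x₀| ≤ ε) (fun k => w n k)
  have hε2 : 0 < ε ^ 2 := by positivity
  have h6 : ∑ k ∈ (range (n + 1)).filter fun k : ℕ => ¬|(k : ℝ) / n - x₀| ≤ ε, w n k ≤ S / 2 := by
    refine le_of_mul_le_mul_left (hout.trans (le_of_eq ?_)) hε2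
    ring
  rw [← hSdef] at hsplit
  rw [window]
  linarith

/-- `binomSum r (2 * n) / binomSum r n ^ 2` tends to infinity. Within a window of relative width `ε`,
Cauchy-Schwarz loses a factor `3 * ε * n`, and the doubling of each summand gains `γ * n` with `γ`
independent of `ε`. -/
theorem eventually_mul_binomSum_sq_le {m : ℕ} {r : Fin (m + 1) → ℕ} (hR : 1 < ∑ j, r j) {x₀ : ℝ}
    (h : SteinWeights (fun n k => (binomTerm r n k : ℝ)) x₀) (h0 : 0 < x₀) (h1 : x₀ < 1) (M : ℝ) :
    ∀ᶠ n : ℕ in atTop, M * (binomSum r n : ℝ) ^ 2 ≤ binomSum r (2 * n) := by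
  set δ := min x₀ (1 - x₀) / 2 with hδdef
  have hmin : 0 < min x₀ (1 - x₀) := lt_min h0 (by linarith)
  have hδ : 0 < δ := by positivity
  have hδ0 : 2 * δ ≤ x₀ := by have := min_le_left x₀ (1 - x₀); linarith
  have hδ1 : 2 * δ ≤ 1 - x₀ := by have := min_le_right x₀ (1 - x₀); linarith
  set γ := δ ^ 2 / ((m : ℝ) + 1) with hγdef
  have hγ : 0 < γ := by positivity
  have hM : 0 < |M| + 1 := by positivity
  -- Half of the sum, squared, costs `4`, and Cauchy-Schwarz costs `3 * ε`: this `ε` makes the net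
  -- gain `γ / (12 * ε)` exceed `M`.
  set ε := min δ (γ / (12 * (|M| + 1))) with hεdef
  have hε : 0 < ε := lt_min hδ (by positivity)
  have hεδ : ε ≤ δ := min_le_left _ _
  have hεM : 12 * ε * (|M| + 1) ≤ γ := by
    have := min_le_right δ (γ / (12 * (|M| + 1)))
    rw [← hεdef, le_div_iff₀ (by positivity)] at this
    linarith
  have hcast := tendsto_natCast_atTop_atTop (R := ℝ)
  filter_upwards [eventually_ge_atTop 1, h.eventually_half_le_sum_window hε,
    hcast.eventually_ge_atTop (1 / ε), hcast.eventually_ge_atTop (1 / γ)] with n hn hhalf hnε hnγ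
  have hn0 : (0 : ℝ) < n := by exact_mod_cast hn
  rw [div_le_iff₀ hε] at hnε
  rw [div_le_iff₀ hγ] at hnγ
  set W := window n x₀ ε with hW
  have hcard : ((#W : ℕ) : ℝ) ≤ 3 * ε * n := by
    have := card_window_le n hn x₀ hε (by linarith)
    rw [← hW] at this
    linarith
  have hterm : ∀ k ∈ W, γ * n * (binomTerm r n k : ℝ) ^ 2 ≤ binomTerm r (2 * n) (2 * k) := by
    intro k hk
    have hk2 := abs_le.1 (mem_filter.1 hk).2
    have e : (k : ℝ) = k / n * n := by field_simp
    refine mul_binomTerm_sq_le hR hδ ?_ ?_ (by rw [← hγdef]; linarith)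
    · rw [e]; gcongr; linarith
    · rw [e]; gcongr; linarith
  have heven : ∑ k ∈ W, (binomTerm r (2 * n) (2 * k) : ℝ) ≤ binomSum r (2 * n) := by
    rw [binomSum_eq_sum_binomTerm]
    push_cast
    rw [← sum_image (s := W) (g := fun k => 2 * k) (f := fun k => (binomTerm r (2 * n) k : ℝ))
      (fun a _ b _ hab => by simpa using hab)]
    refine sum_le_sum_of_subset_of_nonneg (fun k hk => ?_) fun k _ _ => Nat.cast_nonneg _
    obtain ⟨a, ha, rfl⟩ := mem_image.1 hk
    have := mem_range.1 (mem_filter.1 ha).1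
    rw [mem_range]; omega
  have hcs : (∑ k ∈ W, (binomTerm r n k : ℝ)) ^ 2 ≤ #W * ∑ k ∈ W, (binomTerm r n k : ℝ) ^ 2 :=
    sq_sum_le_card_mul_sum_sq
  have hSeq : ∑ k ∈ range (n + 1), (binomTerm r n k : ℝ) = binomSum r n := by
    rw [binomSum_eq_sum_binomTerm]; push_cast; rfl
  rw [hSeq] at hhalf
  have hSpos : (0 : ℝ) < binomSum r n := by exact_mod_cast binomSum_pos r n
  have hsq : ((binomSum r n : ℝ) / 2) ^ 2 ≤ (∑ k ∈ W, (binomTerm r n k : ℝ)) ^ 2 := by gcongr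
  have hQ : γ * n * ∑ k ∈ W, (binomTerm r n k : ℝ) ^ 2 ≤ binomSum r (2 * n) := by
    rw [mul_sum]
    exact (sum_le_sum hterm).trans heven
  have hQ0 : 0 ≤ ∑ k ∈ W, (binomTerm r n k : ℝ) ^ 2 := sum_nonneg fun _ _ => by positivity
  have hchain : γ * (binomSum r n : ℝ) ^ 2 ≤ 12 * ε * binomSum r (2 * n) := by
    calc γ * (binomSum r n : ℝ) ^ 2 = 4 * γ * ((binomSum r n : ℝ) / 2) ^ 2 := by ring
      _ ≤ 4 * γ * (3 * ε * n * ∑ k ∈ W, (binomTerm r n k : ℝ) ^ 2) := by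
          gcongr
          exact hsq.trans (hcs.trans (by gcongr))
      _ = 12 * ε * (γ * n * ∑ k ∈ W, (binomTerm r n k : ℝ) ^ 2) := by ring
      _ ≤ _ := by gcongr
  refine le_of_mul_le_mul_left ?_ (show 0 < 12 * ε by positivity)
  calc 12 * ε * (M * (binomSum r n : ℝ) ^ 2)
      ≤ 12 * ε * ((|M| + 1) * (binomSum r n : ℝ) ^ 2) := by
        gcongr
        linarith [le_abs_self M]
    _ = 12 * ε * (|M| + 1) * (binomSum r n : ℝ) ^ 2 := by ring
    _ ≤ γ * (binomSum r n : ℝ) ^ 2 := by gcongr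
    _ ≤ _ := hchain

/-! ### The root ratios of the binomial sums -/

theorem exists_strictAntiOn_rootRatio_binomSum {m : ℕ} (r : Fin (m + 1) → ℕ) (hr : 0 < r 0)
    (hR : 1 < ∑ j, r j) :
    ∃ N : ℕ, 1 ≤ N ∧ StrictAntiOn (rootRatio (binomSum r)) (Set.Ici N) := by
  obtain ⟨x₀, h0, h1, heq, hne, hderiv⟩ := exists_concentration_point hr
  have hw := binomSteinWeights hr ⟨h0.le, h1.le⟩ heq hne hderiv
  obtain ⟨c, C, hC, hexp⟩ := hw.exists_mean_expansion (analyticOnNhd_consecutiveRatio r)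
  refine exists_strictAntiOn_rootRatio (binomSum_pos r) (consecutiveRatio_pos r h0 h1) hC
    (c := c) (fun n => ?_) (eventually_mul_binomSum_sq_le hR hw h0 h1)
  have := hexp (n + 1) (Nat.le_add_left 1 n)
  rw [weightedMean_consecutiveRatio hr] at this
  exact_mod_cast this

theorem binomSum_two_two : binomSum ![2, 2] = aperyNumber := by
  funext n
  simp [binomSum, aperyNumber, Fin.prod_univ_two]

theorem binomSum_one_one : binomSum ![1, 1] = centralDelannoyNumber := by
  funext n
  simp [binomSum, centralDelannoyNumber, Fin.prod_univ_two]

theorem binomSum_three : binomSum ![3] = franelNumber := by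
  funext n
  simp [binomSum, franelNumber]

theorem theorem2 :
    (∀ (m : ℕ) (r : Fin (m + 1) → ℕ), 0 < r 0 → 1 < ∑ j, r j →
      ∃ N : ℕ, 1 ≤ N ∧ StrictAntiOn (rootRatio (binomSum r)) (Set.Ici N)) ∧
    (∃ N : ℕ, 1 ≤ N ∧ StrictAntiOn (rootRatio aperyNumber) (Set.Ici N)) ∧
    (∃ N : ℕ, 1 ≤ N ∧ StrictAntiOn (rootRatio centralDelannoyNumber) (Set.Ici N)) ∧
    (∃ N : ℕ, 1 ≤ N ∧ StrictAntiOn (rootRatio franelNumber) (Set.Ici N)) := by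
  refine ⟨fun m r hr hR => exists_strictAntiOn_rootRatio_binomSum r hr hR, ?_, ?_, ?_⟩
  · rw [← binomSum_two_two]
    exact exists_strictAntiOn_rootRatio_binomSum _ (by simp) (by simp)
  · rw [← binomSum_one_one]
    exact exists_strictAntiOn_rootRatio_binomSum _ (by simp) (by simp)
  · rw [← binomSum_three]
    exact exists_strictAntiOn_rootRatio_binomSum _ (by simp) (by simp)
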